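/- **Setting.** Let $\mathcal X$ be a measurable space of contexts with a probability measure $d_0$, let $\mathcal A$ be a countable set of actions, and let a policy be a Markov kernel $\pi(\cdot\mid x)$ from $\mathcal X$ to $\mathcal A$. Let $\pi_0$ be a reference policy, $\eta>0$, $B>0$, and let $\mathcal R=\{R(\theta,\cdot,\cdot):\theta\in\Theta\}$ be a class of measurable reward functions $\mathcal X\times\mathcal A\to[0,B]$ containing the true reward $R(\theta_*,\cdot,\cdot)$. Put $$Q(\pi)=\mathbb E_{x\sim d_0}\mathbb E_{a\sim\pi(\cdot|x)}\Big[R(\theta_*,x,a)-\eta^{-1}\log\tfrac{\pi(a|x)}{\pi_0(a|x)}\Big],\qquad \pi_\theta^\eta(a|x)\propto\pi_0(a|x)\,e^{\eta R(\theta,x,a)},\qquad \pi^*=\pi_{\theta_*}^\eta .$$ Let $N_{\mathcal R}(r)$ be the smallest cardinality of a set of functions such that every element of $\mathcal R$ is within sup-distance $r$ of one of them. For $\rho=2\eta B$ let $C_\rho$ be the supremum of $\pi(a|x)/\pi_0(a|x)$ over $d_0$-almost all $x$, all $a\in\mathcal A$ and all policies $\pi$ with $\mathbb E_{x\sim d_0}\mathrm{KL}(\pi(\cdot|x)\|\pi_0(\cdot|x))\le\rho$,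 and assume $C_\rho<\infty$ (local KL-ball coverage). **Algorithm.** With $\sigma(u)=1/(1+e^{-u})$, a query $(x,a^1,a^2)$ to the preference oracle returns $y\in\{0,1\}$ with $\mathbb P(y=1)=\sigma(R(\theta_*,x,a^1)-R(\theta_*,x,a^2))$. Stage 1: draw $m$ i.i.d. observations $(x,a^1,a^2,y)$ with $x\sim d_0$ and $a^1,a^2\sim\pi_0(\cdot|x)$ independent given $x$, and let $\hat\theta_0\in\Theta$ maximize over $\theta\in\Theta$ the log-likelihood $$\sum \big[y\log\sigma(R(\theta,x,a^1)-R(\theta,x,a^2))+(1-y)\log\sigma(R(\theta,x,a^2)-R(\theta,x,a^1))\big].$$ Stage 2: given stage 1, draw $n$ i.i.d. observations in the same way with $\pi_{\hat\theta_0}^\eta$ in place of $\pi_0$, and let $\hat\theta\in\Theta$ maximize the log-likelihood of all $m+n$ observations. The output is $\pi_{\hat\theta}^\eta$. (The maximizers are assumed to exist and to be chosen measurably.) **Statement.** For all $c>0$ and $\kappa>0$ there is a constant $K$, depending only on $c$ and $\kappa$, such that for every problem as above, every $\epsilon>0$, every $\delta\in(0,1/6)$ and all sample sizes with $n=c\,m$: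 1. if $\epsilon_c=\dfrac{\epsilon}{2(1+c^{-1})e^B}$, $N_{\mathcal R}(\epsilon_c)<\infty$ and $n\ge\kappa\, C_\rho\,\dfrac{\eta}{\epsilon}\,e^B\log\dfrac{N_{\mathcal R}(\epsilon_c)}{\delta}$, then with probability at least $1-6\delta$ $$Q(\pi^*)-Q(\pi_{\hat\theta}^\eta)\le K\,(1+\eta\,C_\rho)\,\epsilon ;$$ 2. if $\epsilon_c=\dfrac{\epsilon}{2(1+c^{-1})e^B\,\eta\, C_\rho}$, $N_{\mathcal R}(\epsilon_c)<\infty$ and $n\ge\kappa\, C_\rho\,\dfrac{\eta}{\epsilon}\,e^B\log\dfrac{N_{\mathcal R}(\epsilon_c)}{\delta}$, then with probability at least $1-6\delta$ $$Q(\pi^*)-Q(\pi_{\hat\theta}^\eta)\le K\,\epsilon .$$ In particular both hold when $n=c\,m=\Theta\big(C_\rho\,\eta\,\epsilon^{-1}e^B\log(N_{\mathcal R}(\epsilon_c)/\delta)\big)$. -/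

import Mathlib

open MeasureTheory ProbabilityTheory
open scoped ENNReal

/-- A KL-regularized preference-learning problem with contexts in `X`, actions in the countable
discrete space `A` and reward functions `R θ : X → A → [0, B]` indexed by `θ : Θ`.
A policy is a Markov kernel from `X` to `A`. -/
structure PrefProblem (X A Θ : Type*) [MeasurableSpace X] [MeasurableSpace A]
    [MeasurableSpace Θ] where
  /-- context distribution -/
  d₀ : Measure X
  isProb_d₀ : IsProbabilityMeasure d₀
  /-- reference policy -/
  π₀ : Kernel X A
  isMarkov_π₀ : IsMarkovKernel π₀
  /-- parametrized reward functions -/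
  R : Θ → X → A → ℝ
  measurable_R : Measurable fun p : Θ × X × A => R p.1 p.2.1 p.2.2
  /-- bound on the rewards -/
  B : ℝ
  B_pos : 0 < B
  R_nonneg : ∀ θ x a, 0 ≤ R θ x a
  R_le : ∀ θ x a, R θ x a ≤ B
  /-- parameter of the true reward -/
  θstar : Θ
  /-- KL-regularization parameter -/
  η : ℝ
  η_pos : 0 < η

/-- One observation: a context, two actions, and the preference label
(`true` stands for `y = 1`, the first action is preferred). -/
abbrev Obs (X A : Type*) : Type _ := (X × A × A) × Bool

noncomputable section

namespace PrefProblem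

variable {X A Θ : Type*} [MeasurableSpace X] [MeasurableSpace A] [MeasurableSpace Θ]

instance (P : PrefProblem X A Θ) : IsProbabilityMeasure P.d₀ := P.isProb_d₀

instance (P : PrefProblem X A Θ) : IsMarkovKernel P.π₀ := P.isMarkov_π₀

/-- The policies `π_θ^η(a|x) ∝ π₀(a|x) exp (η R(θ, x, a))`, jointly in `(θ, x)`. -/
def gibbs (P : PrefProblem X A Θ) : Kernel (Θ × X) A where
  toFun p := (P.π₀ p.2).tilted fun a => P.η * P.R p.1 p.2 a
  measurable' := by
    have hf : Measurable fun q : (Θ × X) × A => Real.exp (P.η * P.R q.1.1 q.1.2 q.2) :=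
      Real.measurable_exp.comp ((P.measurable_R.comp
        (f := fun q : (Θ × X) × A => (q.1.1, q.1.2, q.2)) (by fun_prop)).const_mul _)
    have hZ : Measurable fun p : Θ × X =>
        ∫ a, Real.exp (P.η * P.R p.1 p.2 a) ∂(P.π₀ p.2) :=
      (StronglyMeasurable.integral_kernel_prod_right' (κ := P.π₀.comap Prod.snd measurable_snd)
        hf.stronglyMeasurable).measurable
    refine Measure.measurable_of_measurable_coe _ fun s hs => ?_
    simp_rw [tilted_apply' _ _ hs]
    exact Measurable.setLIntegral_kernel_prod_right (κ := P.π₀.comap Prod.snd measurable_snd)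
      (f := fun p a => ENNReal.ofReal (Real.exp (P.η * P.R p.1 p.2 a) /
        ∫ a, Real.exp (P.η * P.R p.1 p.2 a) ∂(P.π₀ p.2)))
      ((hf.div (hZ.comp measurable_fst)).ennreal_ofReal) hs

instance (P : PrefProblem X A Θ) : IsMarkovKernel P.gibbs where
  isProbabilityMeasure p := by
    refine isProbabilityMeasure_tilted (Integrable.of_bound
      (C := Real.exp (P.η * P.B)) ?_ (ae_of_all _ fun a => ?_))
    · exact (Real.measurable_exp.comp ((P.measurable_R.comp
        (f := fun a : A => (p.1, p.2, a)) (by fun_prop)).const_mul _)).aestronglyMeasurable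
    · rw [Real.norm_eq_abs, Real.abs_exp]
      exact Real.exp_le_exp.2 (mul_le_mul_of_nonneg_left (P.R_le _ _ _) P.η_pos.le)

/-- The policy `π_θ^η` returned by the planning oracle for the reward `R θ`. -/
def policy (P : PrefProblem X A Θ) (θ : Θ) : Kernel X A := P.gibbs.sectR θ

instance (P : PrefProblem X A Θ) (θ : Θ) : IsMarkovKernel (P.policy θ) := by
  unfold policy; infer_instance

/-- The KL-regularized objective
`Q(π) = E_{x ∼ d₀} E_{a ∼ π(·|x)} [R(θ_*, x, a) - η⁻¹ log (π(a|x) / π₀(a|x))]`. -/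
def objective (P : PrefProblem X A Θ) (π : Kernel X A) : ℝ :=
  ∫ x, ∫ a, (P.R P.θstar x a - P.η⁻¹ * Real.log ((π x).real {a} / (P.π₀ x).real {a}))
    ∂(π x) ∂P.d₀

/-- The suboptimality `Q(π^*) - Q(π_θ^η)`, where `π^* = π_{θ_*}^η`. -/
def gap (P : PrefProblem X A Θ) (θ : Θ) : ℝ :=
  P.objective (P.policy P.θstar) - P.objective (P.policy θ)

/-- The local KL-ball coverage coefficient `C_ρ`: the supremum of `π(a|x) / π₀(a|x)` over
`d₀`-almost all contexts `x`, all actions `a` and all policies `π` with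
`E_{x ∼ d₀} KL(π(·|x) ‖ π₀(·|x)) ≤ ρ`. -/
def localCoverage (P : PrefProblem X A Θ) (ρ : ℝ) : ℝ≥0∞ :=
  ⨆ (π : Kernel X A) (_ : IsMarkovKernel π)
    (_ : ∫⁻ x, InformationTheory.klDiv (π x) (P.π₀ x) ∂P.d₀ ≤ ENNReal.ofReal ρ),
    essSup (fun x => ⨆ a, π x {a} / P.π₀ x {a}) P.d₀

/-- The covering number `N_R(r)` of the class `{R θ | θ ∈ Θ}` in the supremum norm: the least
cardinality of a set `S` of functions such that every `R θ` is within `r` of a member of `S`. -/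
def coveringNumber (P : PrefProblem X A Θ) (r : ℝ) : ℕ∞ :=
  ⨅ (S : Set (X → A → ℝ)) (_ : ∀ θ, ∃ g ∈ S, ∀ x a, |P.R θ x a - g x a| ≤ r), S.encard

/-- The Bradley-Terry preference oracle:
the label of `(x, a¹, a²)` is Bernoulli with mean `σ(R(θ_*, x, a¹) - R(θ_*, x, a²))`. -/
def label (P : PrefProblem X A Θ) : Kernel (X × A × A) Bool where
  toFun z :=
    ENNReal.ofReal (Real.sigmoid (P.R P.θstar z.1 z.2.1 - P.R P.θstar z.1 z.2.2)) •
        Measure.dirac true +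
      ENNReal.ofReal (1 - Real.sigmoid (P.R P.θstar z.1 z.2.1 - P.R P.θstar z.1 z.2.2)) •
        Measure.dirac false
  measurable' := by
    have h : Measurable fun z : X × A × A =>
        Real.sigmoid (P.R P.θstar z.1 z.2.1 - P.R P.θstar z.1 z.2.2) :=
      continuous_sigmoid.measurable.comp
        ((P.measurable_R.comp (f := fun z : X × A × A => (P.θstar, z.1, z.2.1)) (by fun_prop)).sub
          (P.measurable_R.comp (f := fun z : X × A × A => (P.θstar, z.1, z.2.2)) (by fun_prop)))
    refine Measure.measurable_of_measurable_coe _ fun s _ => ?_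
    simp only [Measure.coe_add, Measure.coe_smul, Pi.add_apply, Pi.smul_apply, smul_eq_mul]
    exact (h.ennreal_ofReal.mul_const _).add ((h.const_sub 1).ennreal_ofReal.mul_const _)

instance (P : PrefProblem X A Θ) : IsMarkovKernel P.label where
  isProbabilityMeasure z := by
    constructor
    simp only [label, Kernel.coe_mk, Measure.coe_add, Measure.coe_smul, Pi.add_apply,
      Pi.smul_apply, measure_univ, smul_eq_mul, mul_one]
    rw [← ENNReal.ofReal_add (Real.sigmoid_nonneg _)
      (sub_nonneg.2 (Real.sigmoid_lt_one _).le)]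
    simp

/-- The law of one observation when both actions are drawn independently from `π`: `x ∼ d₀`,
`a¹, a² ∼ π(·|x)`, and the label comes from the preference oracle. -/
def obsLaw (P : PrefProblem X A Θ) (π : Kernel X A) : Measure (Obs X A) :=
  (P.d₀ ⊗ₘ (π ×ₖ π)) ⊗ₘ P.label

instance (P : PrefProblem X A Θ) (π : Kernel X A) [IsMarkovKernel π] :
    IsProbabilityMeasure (P.obsLaw π) := by
  unfold obsLaw; infer_instance

theorem measurable_obsLaw_policy (P : PrefProblem X A Θ) :
    Measurable fun θ => P.obsLaw (P.policy θ) := by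
  have h : (fun θ => P.obsLaw (P.policy θ)) =
      ⇑((Kernel.const Θ P.d₀ ⊗ₖ (P.gibbs ×ₖ P.gibbs)) ⊗ₖ P.label.prodMkLeft Θ) := by
    funext θ
    rw [Kernel.compProd_apply_eq_compProd_sectR, Kernel.compProd_apply_eq_compProd_sectR,
      Kernel.const_apply]
    have h1 : (P.gibbs ×ₖ P.gibbs).sectR θ = P.policy θ ×ₖ P.policy θ := by
      ext x : 1
      simp [Kernel.prod_apply, policy]
    have h2 : (P.label.prodMkLeft Θ).sectR θ = P.label := by
      ext x : 1
      simp
    rw [h1, h2, obsLaw]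
  rw [h]
  exact Kernel.measurable _

/-- The law of the second-stage data given the first-stage data `D`: `n` independent observations
with actions drawn from `π_{θ̂₀(D)}^η`. -/
def secondStage (P : PrefProblem X A Θ) {m : ℕ} (n : ℕ) (est₀ : (Fin m → Obs X A) → Θ)
    (h₀ : Measurable est₀) : Kernel (Fin m → Obs X A) (Fin n → Obs X A) where
  toFun D := Measure.pi fun _ : Fin n => P.obsLaw (P.policy (est₀ D))
  measurable' := by
    refine Measurable.measure_of_isPiSystem_of_isProbabilityMeasure
      generateFrom_pi.symm isPiSystem_pi ?_
    rintro _ ⟨s, hs, rfl⟩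
    simp_rw [Measure.pi_pi]
    refine Finset.measurable_prod _ fun i _ => ?_
    exact (Measure.measurable_coe (show MeasurableSet (s i) from hs i (Set.mem_univ i))).comp
      (P.measurable_obsLaw_policy.comp h₀)

instance (P : PrefProblem X A Θ) {m : ℕ} (n : ℕ) (est₀ : (Fin m → Obs X A) → Θ)
    (h₀ : Measurable est₀) : IsMarkovKernel (P.secondStage n est₀ h₀) where
  isProbabilityMeasure D := by
    change IsProbabilityMeasure (Measure.pi fun _ : Fin n => P.obsLaw (P.policy (est₀ D)))
    infer_instance

/-- The law of all the data collected by the two-stage algorithm: `m` independent observations with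
actions from `π₀`, then `n` observations with actions from `π_{θ̂₀}^η`, where `θ̂₀` is computed
by `est₀` from the first-stage data. -/
def runLaw (P : PrefProblem X A Θ) (m n : ℕ) (est₀ : (Fin m → Obs X A) → Θ)
    (h₀ : Measurable est₀) : Measure ((Fin m → Obs X A) × (Fin n → Obs X A)) :=
  Measure.pi (fun _ : Fin m => P.obsLaw P.π₀) ⊗ₘ P.secondStage n est₀ h₀

/-- The log-likelihood of one observation in the Bradley-Terry model with reward `R θ`. -/
def logLik (P : PrefProblem X A Θ) (θ : Θ) (o : Obs X A) : ℝ :=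
  if o.2 then Real.log (Real.sigmoid (P.R θ o.1.1 o.1.2.1 - P.R θ o.1.1 o.1.2.2))
  else Real.log (Real.sigmoid (P.R θ o.1.1 o.1.2.2 - P.R θ o.1.1 o.1.2.1))

/-- `est₀` maximizes the likelihood of the first-stage data over `Θ`. -/
def IsFirstMLE (P : PrefProblem X A Θ) {m : ℕ} (est₀ : (Fin m → Obs X A) → Θ) : Prop :=
  ∀ D θ, ∑ i, P.logLik θ (D i) ≤ ∑ i, P.logLik (est₀ D) (D i)

/-- `est` maximizes the likelihood of the data of both stages together over `Θ`. -/
def IsFinalMLE (P : PrefProblem X A Θ) {m n : ℕ}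
    (est : (Fin m → Obs X A) × (Fin n → Obs X A) → Θ) : Prop :=
  ∀ D θ, ∑ i, P.logLik θ (D.1 i) + ∑ i, P.logLik θ (D.2 i) ≤
    ∑ i, P.logLik (est D) (D.1 i) + ∑ i, P.logLik (est D) (D.2 i)

/-- The sample size `C_ρ η / ε · e^B log (N_R(r) / δ)` with `ρ = 2 η B`. -/
def sampleSize (P : PrefProblem X A Θ) (ε δ r : ℝ) : ℝ :=
  (P.localCoverage (2 * P.η * P.B)).toReal * P.η / ε * Real.exp P.B *
    Real.log ((P.coveringNumber r).toNat / δ)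

end PrefProblem

end

noncomputable section

/-! ### Real inequalities -/

/-! The proof has a statistical half, bounding the mean squared error of the reward differences
under the reference policy, and a planning half, showing that this error controls the suboptimality
linearly with factor `η C_ρ`.

Statistics. For fixed `θ`, the expected square root of the likelihood ratio of `θ` to the truth on
one query is a Hellinger affinity of two Bernoulli laws. It is at most `1 - (margin difference)² /
(32 e^B)` (`sqrt_sigmoid_mul_add_le`). Conditionally on stage 1, the stage 2 product of square roots
has mean at most 1 whichever policy was chosen, so adaptivity costs nothing and the `m` stage 1
factors already give exponential decay (`lintegral_runLaw_prod_sqrtRatio_le`). Markov's inequality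
and a union bound over a finite cover show that no centre of large error has a competitive
likelihood. The final maximizer is close to some centre, which is competitive because
log-likelihoods are 1-Lipschitz in the margin; hence its own error is small
(`runLaw_marginError_le`).

Planning. In each context the gap is `η⁻¹ KL(π_θ ‖ π^*)`, a divergence of Gibbs measures. Gibbs
policies lie in the KL ball, so both densities with respect to `π₀` are at most `C_ρ`. A bound on
the symmetrized divergence then gives a quadratic estimate in the reward error, with one power of
`C_ρ` and no factor exponential in `ηB` (`log_partition_sub_le`, `gap_le_marginError`). The sample
size makes the product of the two bounds of order `ε`. -/

theorem log_sigmoid_sub_le (u v : ℝ) :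
    Real.log (Real.sigmoid u) - Real.log (Real.sigmoid v) ≤ |u - v| := by
  have hu : 0 < 1 + Real.exp (-u) := by positivity
  have hv : 0 < 1 + Real.exp (-v) := by positivity
  rw [Real.sigmoid_def, Real.sigmoid_def, Real.log_inv, Real.log_inv, neg_sub_neg,
    ← Real.log_div hv.ne' hu.ne', Real.log_le_iff_le_exp (by positivity), div_le_iff₀ hu, mul_add,
    ← Real.exp_add, mul_one]
  exact add_le_add (Real.one_le_exp (abs_nonneg _))
    (Real.exp_le_exp.2 (by linarith [le_abs_self (u - v)]))

theorem sigmoid_eq_exp_div_cosh (u : ℝ) :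
    Real.sigmoid u = Real.exp (u / 2) / (2 * Real.cosh (u / 2)) := by
  have h : Real.exp (-u) * Real.exp (u / 2) = Real.exp (-(u / 2)) := by
    rw [← Real.exp_add]; ring_nf
  have hp : 0 < 1 + Real.exp (-u) := by positivity
  have hc := Real.cosh_pos (u / 2)
  rw [Real.sigmoid_def, inv_eq_one_div, div_eq_div_iff hp.ne' (by positivity), Real.cosh_eq]
  linear_combination -h

theorem cosh_le_exp_of_abs_le {s b : ℝ} (h : |s| ≤ b) : Real.cosh s ≤ Real.exp b := by
  rw [Real.cosh_eq]
  have h1 := Real.exp_le_exp.2 ((le_abs_self s).trans h)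
  have h2 := Real.exp_le_exp.2 ((neg_le_abs s).trans h)
  linarith

theorem one_add_sq_div_two_le_cosh (t : ℝ) : 1 + t ^ 2 / 2 ≤ Real.cosh t := by
  have h := Real.cosh_two_mul (t / 2)
  have h1 := Real.cosh_sq (t / 2)
  have h2 : (t / 2) ^ 2 ≤ Real.sinh (t / 2) ^ 2 := by
    rw [sq_le_sq, Real.abs_sinh]
    exact Real.self_le_sinh_iff.2 (abs_nonneg _)
  rw [show 2 * (t / 2) = t by ring] at h
  nlinarith

/-- The squared Hellinger affinity of two Bernoulli laws in the logistic parametrization. -/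
theorem sqrt_sigmoid_mul_add_sq (u v : ℝ) :
    (√(Real.sigmoid u * Real.sigmoid v) + √(Real.sigmoid (-u) * Real.sigmoid (-v))) ^ 2 =
      (1 + Real.cosh ((u + v) / 2)) / (Real.cosh ((u + v) / 2) + Real.cosh ((u - v) / 2)) := by
  have hcu := Real.cosh_pos (u / 2)
  have hcv := Real.cosh_pos (v / 2)
  have hsum : Real.cosh ((u + v) / 2) + Real.cosh ((u - v) / 2) =
      2 * (Real.cosh (u / 2) * Real.cosh (v / 2)) := by
    rw [add_div, sub_div, Real.cosh_add, Real.cosh_sub]; ring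
  have h1 : Real.sigmoid u * Real.sigmoid v =
      Real.exp ((u + v) / 4) ^ 2 / (4 * (Real.cosh (u / 2) * Real.cosh (v / 2))) := by
    rw [sigmoid_eq_exp_div_cosh u, sigmoid_eq_exp_div_cosh v, div_mul_div_comm, ← Real.exp_add,
      ← Real.exp_nat_mul]
    congr 1
    · congr 1; push_cast; ring
    · ring
  have h2 : Real.sigmoid (-u) * Real.sigmoid (-v) =
      Real.exp (-((u + v) / 4)) ^ 2 / (4 * (Real.cosh (u / 2) * Real.cosh (v / 2))) := by
    rw [sigmoid_eq_exp_div_cosh (-u), sigmoid_eq_exp_div_cosh (-v), div_mul_div_comm,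
      ← Real.exp_add, ← Real.exp_nat_mul, neg_div, neg_div, Real.cosh_neg, Real.cosh_neg]
    congr 1
    · congr 1; push_cast; ring
    · ring
  have hd := Real.cosh_two_mul ((u + v) / 4)
  have hs := Real.cosh_sq ((u + v) / 4)
  rw [show 2 * ((u + v) / 4) = (u + v) / 2 by ring] at hd
  have he : Real.exp ((u + v) / 4) + Real.exp (-((u + v) / 4)) =
      2 * Real.cosh ((u + v) / 4) := by rw [Real.cosh_eq]; ring
  rw [h1, h2, Real.sqrt_div (sq_nonneg _), Real.sqrt_div (sq_nonneg _),
    Real.sqrt_sq (Real.exp_pos _).le, Real.sqrt_sq (Real.exp_pos _).le, ← add_div, he, div_pow,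
    Real.sq_sqrt (by positivity), hsum, div_eq_div_iff (by positivity) (by positivity)]
  have : 1 + Real.cosh ((u + v) / 2) = 2 * Real.cosh ((u + v) / 4) ^ 2 := by linarith
  rw [this]; ring

/-- With `s = (u+v)/2` and `t = (u-v)/2`, the squared affinity falls short of 1 by `(cosh t - 1) /
(cosh s + cosh t)`. The numerator is at least `t²/2` and the denominator at most `2 e^b`. Since
`|s|, |t| ≤ b`, only one factor `e^b` is lost. -/
theorem sqrt_sigmoid_mul_add_le {u v b : ℝ} (hu : |u| ≤ b) (hv : |v| ≤ b) :
    √(Real.sigmoid u * Real.sigmoid v) + √(Real.sigmoid (-u) * Real.sigmoid (-v)) ≤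
      1 - (u - v) ^ 2 / (32 * Real.exp b) := by
  set w := √(Real.sigmoid u * Real.sigmoid v) + √(Real.sigmoid (-u) * Real.sigmoid (-v)) with hw
  have hsq := sqrt_sigmoid_mul_add_sq u v
  rw [← hw] at hsq
  have hs : Real.cosh ((u + v) / 2) ≤ Real.exp b := by
    refine cosh_le_exp_of_abs_le ?_
    rw [abs_le] at hu hv ⊢
    constructor <;> linarith [hu.1, hu.2, hv.1, hv.2]
  have ht : Real.cosh ((u - v) / 2) ≤ Real.exp b := by
    refine cosh_le_exp_of_abs_le ?_
    rw [abs_le] at hu hv ⊢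
    constructor <;> linarith [hu.1, hu.2, hv.1, hv.2]
  have hs1 := Real.one_le_cosh ((u + v) / 2)
  have ht1 := one_add_sq_div_two_le_cosh ((u - v) / 2)
  have ht0 := Real.one_le_cosh ((u - v) / 2)
  have hdef : (u - v) ^ 2 / (16 * Real.exp b) ≤ 1 - w ^ 2 := by
    rw [hsq, one_sub_div (by positivity), div_le_div_iff₀ (by positivity) (by positivity)]
    have h1 : (u - v) ^ 2 * (Real.cosh ((u + v) / 2) + Real.cosh ((u - v) / 2)) ≤
        (u - v) ^ 2 * (2 * Real.exp b) :=
      mul_le_mul_of_nonneg_left (by linarith) (sq_nonneg _)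
    have h2 : (u - v) ^ 2 / 8 * (16 * Real.exp b) ≤
        (Real.cosh ((u - v) / 2) - 1) * (16 * Real.exp b) :=
      mul_le_mul_of_nonneg_right (by linarith) (by positivity)
    linarith
  have h32 : (u - v) ^ 2 / (32 * Real.exp b) = (u - v) ^ 2 / (16 * Real.exp b) / 2 := by
    rw [div_div]; ring_nf
  rw [h32]
  -- From squared affinity to affinity: `1 - w ≥ (1 - w²)/2`.
  nlinarith [sq_nonneg (w - 1)]

theorem mul_exp_half_log_sub {s t : ℝ} (hs : 0 < s) (ht : 0 < t) :
    t * Real.exp ((Real.log s - Real.log t) / 2) = √(s * t) := by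
  rw [← Real.log_div hs.ne' ht.ne', ← Real.log_sqrt (by positivity),
    Real.exp_log (Real.sqrt_pos.2 (by positivity)), Real.sqrt_div hs.le, Real.sqrt_mul hs.le]
  nth_rewrite 1 [← Real.mul_self_sqrt ht.le]
  have := Real.sqrt_pos.2 ht
  field_simp

/-- Young's inequality weighted by the larger of two densities `p` and `q = p e^l`. -/
theorem sub_mul_le_of_eq_mul_exp {p q l M h : ℝ} (hp : 0 < p) (hq : q = p * Real.exp l)
    (hpM : p ≤ M) (hqM : q ≤ M) :
    (q - p) * h ≤ (q - p) * l / 2 + M * h ^ 2 / 2 := by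
  have hM : 0 < M := hp.trans_le hpM
  have hq0 : 0 < q := by rw [hq]; positivity
  -- From `1 + x ≤ e^x`, `|q - p| ≤ max(p, q) |l|`, and `q - p` has the sign of `l`. The claim then
  -- follows by completing the square in `q - p - M h`.
  have hkey : (q - p) ^ 2 ≤ M * ((q - p) * l) := by
    rcases le_total 0 l with hl | hl
    · have h1 : p ≤ q := by rw [hq]; exact le_mul_of_one_le_right hp.le (Real.one_le_exp hl)
      have h2 : q - p ≤ q * l := by
        have h3 : p = q * Real.exp (-l) := by
          rw [hq, mul_assoc, ← Real.exp_add]; simp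
        nlinarith [Real.add_one_le_exp (-l)]
      have h4 : q * l ≤ M * l := mul_le_mul_of_nonneg_right hqM hl
      nlinarith
    · have h1 : q ≤ p := by
        rw [hq]; exact mul_le_of_le_one_right hp.le (Real.exp_le_one_iff.2 hl)
      have h2 : p - q ≤ p * -l := by
        rw [hq]; nlinarith [Real.add_one_le_exp l]
      have h4 : p * -l ≤ M * -l := mul_le_mul_of_nonneg_right hpM (by linarith)
      nlinarith
  have : M * ((q - p) * h) ≤ M * ((q - p) * l / 2 + M * h ^ 2 / 2) := by
    nlinarith [sq_nonneg (q - p - M * h)]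
  exact le_of_mul_le_mul_left this hM

/-! ### Product measures -/

theorem lintegral_pi_prod_eq_pow {α : Type*} [MeasurableSpace α] (μ : Measure α)
    [IsProbabilityMeasure μ] (n : ℕ) {g : α → ℝ≥0∞} (hg : Measurable g) :
    ∫⁻ D : Fin n → α, ∏ i, g (D i) ∂Measure.pi (fun _ => μ) = (∫⁻ o, g o ∂μ) ^ n := by
  have hind : iIndepFun (fun (i : Fin n) (D : Fin n → α) => g (D i))
      (Measure.pi (fun _ => μ)) :=
    iIndepFun_pi (X := fun _ => g) fun _ => hg.aemeasurable
  have h := lintegral_prod_eq_prod_lintegral_of_indepFun Finset.univ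
    (fun (i : Fin n) (D : Fin n → α) => g (D i)) hind
    (fun i => hg.comp (measurable_pi_apply i))
  rw [h]
  have h2 : ∀ i : Fin n, ∫⁻ D : Fin n → α, g (D i) ∂Measure.pi (fun _ => μ) = ∫⁻ o, g o ∂μ :=
    fun i => (measurePreserving_eval (fun _ : Fin n => μ) i).lintegral_comp hg
  simp [h2]

namespace PrefProblem

variable {X A Θ : Type*} [MeasurableSpace X] [MeasurableSpace A] [MeasurableSpace Θ]

/-! ### Likelihood of the observations -/

/-- The reward difference of the two actions of a query. -/
def margin (P : PrefProblem X A Θ) (θ : Θ) (z : X × A × A) : ℝ :=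
  P.R θ z.1 z.2.1 - P.R θ z.1 z.2.2

/-- The mean squared error of the reward differences when both actions are drawn from `π`. -/
def marginError (P : PrefProblem X A Θ) (π : Kernel X A) (θ : Θ) : ℝ :=
  ∫ z, (P.margin θ z - P.margin P.θstar z) ^ 2 ∂(P.d₀ ⊗ₘ (π ×ₖ π))

theorem measurable_R_apply (P : PrefProblem X A Θ) (θ : Θ) :
    Measurable fun p : X × A => P.R θ p.1 p.2 :=
  P.measurable_R.comp (f := fun p : X × A => (θ, p.1, p.2)) (by fun_prop)

theorem measurable_margin (P : PrefProblem X A Θ) (θ : Θ) : Measurable (P.margin θ) :=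
  ((P.measurable_R_apply θ).comp (f := fun z : X × A × A => (z.1, z.2.1)) (by fun_prop)).sub
    ((P.measurable_R_apply θ).comp (f := fun z : X × A × A => (z.1, z.2.2)) (by fun_prop))

theorem abs_margin_le (P : PrefProblem X A Θ) (θ : Θ) (z : X × A × A) :
    |P.margin θ z| ≤ P.B := by
  have h1 := P.R_nonneg θ z.1 z.2.1
  have h2 := P.R_nonneg θ z.1 z.2.2
  have h3 := P.R_le θ z.1 z.2.1
  have h4 := P.R_le θ z.1 z.2.2
  rw [margin, abs_le]
  constructor <;> linarith

theorem logLik_eq (P : PrefProblem X A Θ) (θ : Θ) (o : Obs X A) :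
    P.logLik θ o = if o.2 then Real.log (Real.sigmoid (P.margin θ o.1))
      else Real.log (Real.sigmoid (-P.margin θ o.1)) := by
  simp only [logLik, margin, neg_sub]

theorem logLik_sub_le (P : PrefProblem X A Θ) (θ θ' : Θ) (o : Obs X A) :
    P.logLik θ o - P.logLik θ' o ≤ |P.margin θ o.1 - P.margin θ' o.1| := by
  rw [logLik_eq, logLik_eq]
  split_ifs
  · exact log_sigmoid_sub_le _ _
  · refine (log_sigmoid_sub_le _ _).trans_eq ?_
    rw [neg_sub_neg, abs_sub_comm]

theorem measurable_logLik (P : PrefProblem X A Θ) (θ : Θ) : Measurable (P.logLik θ) := by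
  have hm : Measurable fun o : Obs X A => P.margin θ o.1 :=
    (P.measurable_margin θ).comp measurable_fst
  have : P.logLik θ = fun o => if o.2 = true then Real.log (Real.sigmoid (P.margin θ o.1))
      else Real.log (Real.sigmoid (-P.margin θ o.1)) := funext (P.logLik_eq θ)
  rw [this]
  refine Measurable.ite (measurable_snd (measurableSet_singleton true)) ?_ ?_
  · exact (continuous_sigmoid.measurable.comp hm).log
  · exact (continuous_sigmoid.measurable.comp hm.neg).log

theorem integrable_marginError (P : PrefProblem X A Θ) (π : Kernel X A) [IsMarkovKernel π]
    (θ θ' : Θ) :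
    Integrable (fun z => (P.margin θ z - P.margin θ' z) ^ 2) (P.d₀ ⊗ₘ (π ×ₖ π)) := by
  refine Integrable.of_bound (C := (2 * P.B) ^ 2)
    (((P.measurable_margin θ).sub (P.measurable_margin θ')).pow_const 2).aestronglyMeasurable
    (ae_of_all _ fun z => ?_)
  rw [Real.norm_eq_abs, abs_pow]
  have := abs_sub (P.margin θ z) (P.margin θ' z)
  have h1 := P.abs_margin_le θ z
  have h2 := P.abs_margin_le θ' z
  gcongr
  linarith

theorem marginError_nonneg (P : PrefProblem X A Θ) (π : Kernel X A) (θ : Θ) :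
    0 ≤ P.marginError π θ := integral_nonneg fun _ => sq_nonneg _

/-- The square root of the likelihood ratio of `θ` and `θ_*`. -/
def sqrtRatio (P : PrefProblem X A Θ) (θ : Θ) (o : Obs X A) : ℝ≥0∞ :=
  ENNReal.ofReal (Real.exp ((P.logLik θ o - P.logLik P.θstar o) / 2))

theorem measurable_sqrtRatio (P : PrefProblem X A Θ) (θ : Θ) : Measurable (P.sqrtRatio θ) :=
  (((P.measurable_logLik θ).sub (P.measurable_logLik P.θstar)).div_const 2).exp.ennreal_ofReal

/-- Averaging over a label drawn from the truth turns the square-root ratio into the Hellinger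
affinity of the two Bernoulli laws. -/
theorem lintegral_label_sqrtRatio_le (P : PrefProblem X A Θ) (θ : Θ) (z : X × A × A) :
    ∫⁻ y, P.sqrtRatio θ (z, y) ∂P.label z ≤
      ENNReal.ofReal (1 - (P.margin θ z - P.margin P.θstar z) ^ 2 / (32 * Real.exp P.B)) := by
  have hl : P.label z = ENNReal.ofReal (Real.sigmoid (P.margin P.θstar z)) • Measure.dirac true +
      ENNReal.ofReal (Real.sigmoid (-P.margin P.θstar z)) • Measure.dirac false := by
    rw [Real.sigmoid_neg]; rfl
  rw [hl, lintegral_add_measure, lintegral_smul_measure, lintegral_smul_measure, lintegral_dirac,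
    lintegral_dirac, smul_eq_mul, smul_eq_mul, sqrtRatio, sqrtRatio,
    ← ENNReal.ofReal_mul (Real.sigmoid_nonneg _), ← ENNReal.ofReal_mul (Real.sigmoid_nonneg _),
    ← ENNReal.ofReal_add (mul_nonneg (Real.sigmoid_nonneg _) (Real.exp_pos _).le)
      (mul_nonneg (Real.sigmoid_nonneg _) (Real.exp_pos _).le)]
  refine ENNReal.ofReal_le_ofReal ?_
  simp only [logLik_eq, if_true, Bool.false_eq_true, if_false]
  rw [mul_exp_half_log_sub (Real.sigmoid_pos _) (Real.sigmoid_pos _),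
    mul_exp_half_log_sub (Real.sigmoid_pos _) (Real.sigmoid_pos _)]
  exact sqrt_sigmoid_mul_add_le (P.abs_margin_le θ z) (P.abs_margin_le _ z)

/-- The affinity bound is averaged over queries before `1 - x ≤ e^{-x}` is applied; the exponential
form is the one that multiplies over independent observations. -/
theorem lintegral_sqrtRatio_le (P : PrefProblem X A Θ) (π : Kernel X A) [IsMarkovKernel π]
    (θ : Θ) :
    ∫⁻ o, P.sqrtRatio θ o ∂P.obsLaw π ≤
      ENNReal.ofReal (Real.exp (-(P.marginError π θ / (32 * Real.exp P.B)))) := by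
  rw [obsLaw, Measure.lintegral_compProd (P.measurable_sqrtRatio θ)]
  refine (lintegral_mono fun z => P.lintegral_label_sqrtRatio_le θ z).trans ?_
  have hi := (P.integrable_marginError π θ P.θstar).div_const (32 * Real.exp P.B)
  rw [← ofReal_integral_eq_lintegral_ofReal (f := fun z => 1 -
    (P.margin θ z - P.margin P.θstar z) ^ 2 / (32 * Real.exp P.B)) ((integrable_const 1).sub hi)]
  · refine ENNReal.ofReal_le_ofReal ?_
    rw [integral_sub (integrable_const 1) hi, integral_div]
    simp only [integral_const, probReal_univ, smul_eq_mul, mul_one]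
    rw [← marginError]
    linarith [Real.add_one_le_exp (-(P.marginError π θ / (32 * Real.exp P.B)))]
  · refine ae_of_all _ fun z => ?_
    have h := sqrt_sigmoid_mul_add_le (P.abs_margin_le θ z) (P.abs_margin_le P.θstar z)
    exact le_trans (by positivity) h

/-- Integrating out stage 2 first leaves a factor at most 1 for every stage 1 outcome. What remains
is an i.i.d. product under `π₀`, so the decay is in terms of the error under `π₀`. -/
theorem lintegral_runLaw_prod_sqrtRatio_le (P : PrefProblem X A Θ) (m n : ℕ)
    (est₀ : (Fin m → Obs X A) → Θ) (h₀ : Measurable est₀) (θ : Θ) :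
    ∫⁻ D, (∏ i, P.sqrtRatio θ (D.1 i)) * ∏ i, P.sqrtRatio θ (D.2 i) ∂P.runLaw m n est₀ h₀ ≤
      ENNReal.ofReal (Real.exp (-(m * (P.marginError P.π₀ θ / (32 * Real.exp P.B))))) := by
  have hmeas : ∀ k : ℕ, Measurable fun D : Fin k → Obs X A => ∏ i, P.sqrtRatio θ (D i) :=
    fun k => Finset.measurable_prod _ fun i _ =>
      (P.measurable_sqrtRatio θ).comp (measurable_pi_apply i)
  rw [runLaw, Measure.lintegral_compProd (f := fun D : (Fin m → Obs X A) × (Fin n → Obs X A) =>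
    (∏ i, P.sqrtRatio θ (D.1 i)) * ∏ i, P.sqrtRatio θ (D.2 i))
    (((hmeas m).comp measurable_fst).mul ((hmeas n).comp measurable_snd))]
  calc ∫⁻ D, ∫⁻ D', (∏ i, P.sqrtRatio θ (D i)) * ∏ i, P.sqrtRatio θ (D' i)
        ∂P.secondStage n est₀ h₀ D ∂Measure.pi (fun _ : Fin m => P.obsLaw P.π₀)
      ≤ ∫⁻ D, ∏ i, P.sqrtRatio θ (D i) ∂Measure.pi (fun _ : Fin m => P.obsLaw P.π₀) := by
        refine lintegral_mono fun D => ?_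
        rw [lintegral_const_mul _ (hmeas n)]
        refine mul_le_of_le_one_right' ?_
        change ∫⁻ D', ∏ i, P.sqrtRatio θ (D' i)
          ∂Measure.pi (fun _ : Fin n => P.obsLaw (P.policy (est₀ D))) ≤ 1
        rw [lintegral_pi_prod_eq_pow _ _ (P.measurable_sqrtRatio θ)]
        refine pow_le_one' ((P.lintegral_sqrtRatio_le _ θ).trans ?_) n
        rw [ENNReal.ofReal_le_one, Real.exp_le_one_iff, neg_nonpos]
        exact div_nonneg (P.marginError_nonneg _ _) (by positivity)
    _ = (∫⁻ o, P.sqrtRatio θ o ∂P.obsLaw P.π₀) ^ m :=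
        lintegral_pi_prod_eq_pow _ _ (P.measurable_sqrtRatio θ)
    _ ≤ ENNReal.ofReal (Real.exp (-(P.marginError P.π₀ θ / (32 * Real.exp P.B)))) ^ m :=
        pow_le_pow_left' (P.lintegral_sqrtRatio_le _ θ) m
    _ = _ := by
        rw [← ENNReal.ofReal_pow (Real.exp_pos _).le, ← Real.exp_nat_mul, mul_neg]

/-- The log-likelihood ratio of `θ` and `θ_*` on all the data. -/
def totalLogRatio (P : PrefProblem X A Θ) {m n : ℕ} (θ : Θ)
    (D : (Fin m → Obs X A) × (Fin n → Obs X A)) : ℝ :=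
  ∑ i, (P.logLik θ (D.1 i) - P.logLik P.θstar (D.1 i)) +
    ∑ i, (P.logLik θ (D.2 i) - P.logLik P.θstar (D.2 i))

/-- The log-likelihood ratio of a fixed `θ` is unlikely to be much larger than minus the error
of `θ`. -/
theorem runLaw_totalLogRatio_ge_le (P : PrefProblem X A Θ) (m n : ℕ)
    (est₀ : (Fin m → Obs X A) → Θ) (h₀ : Measurable est₀) (θ : Θ) (s : ℝ) :
    P.runLaw m n est₀ h₀ {D | s - m * (P.marginError P.π₀ θ / (32 * Real.exp P.B)) ≤
      P.totalLogRatio θ D / 2} ≤ ENNReal.ofReal (Real.exp (-s)) := by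
  set v := m * (P.marginError P.π₀ θ / (32 * Real.exp P.B)) with hv
  have hprod : ∀ D : (Fin m → Obs X A) × (Fin n → Obs X A),
      (∏ i, P.sqrtRatio θ (D.1 i)) * ∏ i, P.sqrtRatio θ (D.2 i) =
        ENNReal.ofReal (Real.exp (P.totalLogRatio θ D / 2)) := by
    intro D
    simp only [sqrtRatio]
    rw [← ENNReal.ofReal_prod_of_nonneg fun _ _ => (Real.exp_pos _).le,
      ← ENNReal.ofReal_prod_of_nonneg fun _ _ => (Real.exp_pos _).le,
      ← ENNReal.ofReal_mul (Finset.prod_nonneg fun _ _ => (Real.exp_pos _).le), ← Real.exp_sum,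
      ← Real.exp_sum, ← Real.exp_add, ← Finset.sum_div, ← Finset.sum_div, ← add_div]
    rfl
  have hmeas : Measurable fun D : (Fin m → Obs X A) × (Fin n → Obs X A) =>
      ENNReal.ofReal (Real.exp (P.totalLogRatio θ D / 2)) := by
    have h := (P.measurable_logLik θ).sub (P.measurable_logLik P.θstar)
    refine ((Measurable.add ?_ ?_).div_const 2).exp.ennreal_ofReal
    · exact Finset.measurable_sum _ fun i _ =>
        h.comp ((measurable_pi_apply i).comp measurable_fst)
    · exact Finset.measurable_sum _ fun i _ =>
        h.comp ((measurable_pi_apply i).comp measurable_snd)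
  have hle := P.lintegral_runLaw_prod_sqrtRatio_le m n est₀ h₀ θ
  simp_rw [hprod] at hle
  rw [← hv] at hle
  have hpos : ENNReal.ofReal (Real.exp (s - v)) ≠ 0 := by simp [Real.exp_pos]
  -- Markov at the level `e^{s-v}`: the mean `e^{-v}` divided by it is `e^{-s}`.
  have hmarkov := meas_ge_le_lintegral_div (μ := P.runLaw m n est₀ h₀) hmeas.aemeasurable hpos
    ENNReal.ofReal_ne_top
  calc P.runLaw m n est₀ h₀ {D | s - v ≤ P.totalLogRatio θ D / 2}
      ≤ P.runLaw m n est₀ h₀ {D | ENNReal.ofReal (Real.exp (s - v)) ≤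
          ENNReal.ofReal (Real.exp (P.totalLogRatio θ D / 2))} :=
        measure_mono fun D hD => ENNReal.ofReal_le_ofReal (Real.exp_le_exp.2 hD)
    _ ≤ _ := hmarkov
    _ ≤ ENNReal.ofReal (Real.exp (-v)) / ENNReal.ofReal (Real.exp (s - v)) :=
        ENNReal.div_le_div_right hle _
    _ = _ := by
        rw [← ENNReal.ofReal_div_of_pos (Real.exp_pos _), ← Real.exp_sub]
        congr 2
        ring

/-! ### Covering the reward class -/

/-- The covering functions may lie outside the class, while likelihood ratios need parameters.
Replacing each function by a class member within `r` of it doubles the radius. -/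
theorem exists_finset_cover (P : PrefProblem X A Θ) {r : ℝ} (hN : P.coveringNumber r ≠ ⊤) :
    ∃ T : Finset Θ, T.card ≤ (P.coveringNumber r).toNat ∧
      ∀ θ, ∃ θ' ∈ T, ∀ x a, |P.R θ x a - P.R θ' x a| ≤ 2 * r := by
  classical
  -- The infimum is attained: some cover has fewer than `N + 1` elements, hence at most `N`.
  have hlt : P.coveringNumber r < P.coveringNumber r + 1 := by
    obtain ⟨N, hN'⟩ := ENat.ne_top_iff_exists.1 hN
    rw [← hN']
    exact_mod_cast Nat.lt_succ_self N
  nth_rewrite 1 [coveringNumber] at hlt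
  simp only [iInf_lt_iff] at hlt
  obtain ⟨S, hS, hcard⟩ := hlt
  have hcard' : S.encard ≤ P.coveringNumber r := Order.le_of_lt_add_one hcard
  have hfin : S.Finite := Set.encard_ne_top_iff.1 (ne_top_of_le_ne_top hN hcard')
  have hch : ∀ g : X → A → ℝ, ∃ θ' : Θ, ∀ θ, (∀ x a, |P.R θ x a - g x a| ≤ r) →
      ∀ x a, |P.R θ x a - P.R θ' x a| ≤ 2 * r := by
    intro g
    by_cases h : ∃ θ', ∀ x a, |P.R θ' x a - g x a| ≤ r
    · obtain ⟨θ', h'⟩ := h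
      refine ⟨θ', fun θ hθ x a => ?_⟩
      have h1 := abs_le.1 (h' x a)
      have h2 := abs_le.1 (hθ x a)
      rw [abs_le]
      constructor <;> linarith [h1.1, h1.2, h2.1, h2.2]
    · exact ⟨P.θstar, fun θ hθ => (h ⟨θ, hθ⟩).elim⟩
  choose t ht using hch
  refine ⟨hfin.toFinset.image t, ?_, fun θ => ?_⟩
  · refine Finset.card_image_le.trans ?_
    rw [hfin.encard_eq_coe_toFinset_card] at hcard'
    exact ENat.toNat_le_toNat hcard' hN
  · obtain ⟨g, hg, hgθ⟩ := hS θ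
    exact ⟨t g, Finset.mem_image_of_mem t (hfin.mem_toFinset.2 hg), ht g θ hgθ⟩

/-- The margins of `θ` and `θ'` differ by at most `4r` and also by at most `2B`. Using each bound
once keeps the remainder linear in `r`, without any smallness of `r`, and `B ≤ e^B`. -/
theorem marginError_le_two_mul_add (P : PrefProblem X A Θ) (π : Kernel X A) [IsMarkovKernel π]
    {θ θ' : Θ} {r : ℝ} (h : ∀ x a, |P.R θ x a - P.R θ' x a| ≤ 2 * r) :
    P.marginError π θ ≤ 2 * P.marginError π θ' + 16 * (r * Real.exp P.B) := by
  have hpt : ∀ z, (P.margin θ z - P.margin P.θstar z) ^ 2 ≤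
      2 * (P.margin θ' z - P.margin P.θstar z) ^ 2 + 16 * (r * Real.exp P.B) := by
    intro z
    have h1 : |P.margin θ z - P.margin θ' z| ≤ 4 * r := by
      have h2 := abs_le.1 (h z.1 z.2.1)
      have h3 := abs_le.1 (h z.1 z.2.2)
      rw [margin, margin, abs_le]
      constructor <;> linarith [h2.1, h2.2, h3.1, h3.2]
    have h2 : |P.margin θ z - P.margin θ' z| ≤ 2 * P.B := by
      linarith [abs_sub (P.margin θ z) (P.margin θ' z), P.abs_margin_le θ z, P.abs_margin_le θ' z]
    have hr : 0 ≤ 4 * r := (abs_nonneg _).trans h1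
    have h3 : (P.margin θ z - P.margin θ' z) ^ 2 ≤ 4 * r * (2 * P.B) := by
      rw [← sq_abs, sq]
      exact mul_le_mul h1 h2 (abs_nonneg _) hr
    have h4 : P.B ≤ Real.exp P.B := by linarith [Real.add_one_le_exp P.B]
    have h5 : r * P.B ≤ r * Real.exp P.B := mul_le_mul_of_nonneg_left h4 (by linarith)
    nlinarith [sq_nonneg ((P.margin θ z - P.margin θ' z) - (P.margin θ' z - P.margin P.θstar z))]
  have hi := (P.integrable_marginError π θ' P.θstar).const_mul 2
  calc P.marginError π θ
      ≤ ∫ z, (2 * (P.margin θ' z - P.margin P.θstar z) ^ 2 + 16 * (r * Real.exp P.B))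
          ∂(P.d₀ ⊗ₘ (π ×ₖ π)) :=
        integral_mono (P.integrable_marginError π θ P.θstar) (hi.add (integrable_const _)) hpt
    _ = _ := by
        rw [integral_add hi (integrable_const _), integral_const_mul]
        simp [marginError]

/-- The maximizer does at least as well as `θ_*`, and passing to a centre moves each margin, hence
each log-likelihood, by at most `4r`. -/
theorem totalLogRatio_ge_of_isFinalMLE (P : PrefProblem X A Θ) {m n : ℕ}
    {est : (Fin m → Obs X A) × (Fin n → Obs X A) → Θ} (hmle : P.IsFinalMLE est)
    (D : (Fin m → Obs X A) × (Fin n → Obs X A)) {θ' : Θ} {r : ℝ}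
    (h : ∀ x a, |P.R (est D) x a - P.R θ' x a| ≤ 2 * r) :
    -((m + n) * (4 * r)) ≤ P.totalLogRatio θ' D := by
  have hpt : ∀ o, P.logLik (est D) o - 4 * r ≤ P.logLik θ' o := by
    intro o
    have h1 : |P.margin (est D) o.1 - P.margin θ' o.1| ≤ 4 * r := by
      have h2 := abs_le.1 (h o.1.1 o.1.2.1)
      have h3 := abs_le.1 (h o.1.1 o.1.2.2)
      rw [margin, margin, abs_le]
      constructor <;> linarith [h2.1, h2.2, h3.1, h3.2]
    linarith [P.logLik_sub_le (est D) θ' o]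
  have h1 : ∑ i, (P.logLik (est D) (D.1 i) - 4 * r) ≤ ∑ i, P.logLik θ' (D.1 i) :=
    Finset.sum_le_sum fun i _ => hpt _
  have h2 : ∑ i, (P.logLik (est D) (D.2 i) - 4 * r) ≤ ∑ i, P.logLik θ' (D.2 i) :=
    Finset.sum_le_sum fun i _ => hpt _
  have h3 := hmle D P.θstar
  simp only [Finset.sum_sub_distrib, Finset.sum_const, Finset.card_univ, Fintype.card_fin,
    nsmul_eq_mul] at h1 h2
  simp only [totalLogRatio, Finset.sum_sub_distrib]
  linarith

/-- With high probability the final maximum likelihood estimator has a small mean squared error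
under the reference policy. -/
theorem runLaw_marginError_le (P : PrefProblem X A Θ) {m n : ℕ} (hm : 0 < m)
    (est₀ : (Fin m → Obs X A) → Θ) (h₀ : Measurable est₀)
    {est : (Fin m → Obs X A) × (Fin n → Obs X A) → Θ} (hmle : P.IsFinalMLE est)
    {δ r : ℝ} (hδ : 0 < δ) (hN : P.coveringNumber r ≠ ⊤) :
    ENNReal.ofReal (1 - δ) ≤ P.runLaw m n est₀ h₀ {D | P.marginError P.π₀ (est D) ≤
      Real.exp P.B * (64 * (Real.log ((P.coveringNumber r).toNat / δ) / m) +
        (128 * (1 + n / m) + 16) * r)} := by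
  obtain ⟨T, hTcard, hT⟩ := P.exists_finset_cover hN
  set N := (P.coveringNumber r).toNat
  set μ := P.runLaw m n est₀ h₀ with hμ
  have : IsProbabilityMeasure μ := by rw [hμ, runLaw]; infer_instance
  have hm' : (0 : ℝ) < m := by exact_mod_cast hm
  have hNpos : (0 : ℝ) < N := by
    obtain ⟨θ', hθ', -⟩ := hT P.θstar
    exact_mod_cast (Finset.card_pos.2 ⟨θ', hθ'⟩).trans_le hTcard
  -- With this level each centre fails with probability at most `e^{-L} = δ/N`, and there are at
  -- most `N` centres.
  set L := Real.log (N / δ) with hL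
  set bad : Θ → Set ((Fin m → Obs X A) × (Fin n → Obs X A)) := fun θ =>
    {D | L - m * (P.marginError P.π₀ θ / (32 * Real.exp P.B)) ≤ P.totalLogRatio θ D / 2}
  have hbad : μ (⋃ θ ∈ T, bad θ) ≤ ENNReal.ofReal δ := by
    refine (measure_biUnion_finset_le T bad).trans ?_
    refine (Finset.sum_le_sum fun θ _ => P.runLaw_totalLogRatio_ge_le m n est₀ h₀ θ L).trans ?_
    rw [Finset.sum_const, hL, Real.exp_neg, Real.exp_log (by positivity), nsmul_eq_mul, inv_div,
      ← ENNReal.ofReal_natCast, ← ENNReal.ofReal_mul (Nat.cast_nonneg _)]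
    refine ENNReal.ofReal_le_ofReal ?_
    rw [mul_div_assoc', div_le_iff₀ hNpos, mul_comm]
    exact mul_le_mul_of_nonneg_left (by exact_mod_cast hTcard) hδ.le
  set good := {D | P.marginError P.π₀ (est D) ≤ Real.exp P.B * (64 * (L / m) +
        (128 * (1 + n / m) + 16) * r)}
  have hsub : goodᶜ ⊆ ⋃ θ ∈ T, bad θ := by
    intro D hD
    by_contra hnb
    refine hD ?_
    obtain ⟨θ', hθ', hclose⟩ := hT (est D)
    have hnb' : ¬ (L - m * (P.marginError P.π₀ θ' / (32 * Real.exp P.B)) ≤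
        P.totalLogRatio θ' D / 2) := fun h => hnb (Set.mem_biUnion hθ' h)
    have h1 := P.totalLogRatio_ge_of_isFinalMLE hmle D hclose
    have h2 := P.marginError_le_two_mul_add P.π₀ hclose
    have h3 : m * (P.marginError P.π₀ θ' / (32 * Real.exp P.B)) ≤ L + (m + n) * (2 * r) := by
      linarith [not_le.1 hnb']
    have h4 : P.marginError P.π₀ θ' ≤ (L + (m + n) * (2 * r)) / m * (32 * Real.exp P.B) := by
      rw [← div_le_iff₀ (by positivity), le_div_iff₀ hm']
      linarith
    change P.marginError P.π₀ (est D) ≤ _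
    calc P.marginError P.π₀ (est D)
        ≤ 2 * ((L + (m + n) * (2 * r)) / m * (32 * Real.exp P.B)) + 16 * (r * Real.exp P.B) := by
          linarith
      _ = _ := by field_simp; ring
  -- Subadditivity avoids having to prove that `good` is measurable.
  have h1 : (1 : ℝ≥0∞) ≤ μ good + μ goodᶜ := by
    rw [← measure_univ (μ := μ), ← Set.union_compl_self good]
    exact measure_union_le _ _
  rw [ENNReal.ofReal_sub _ hδ.le, ENNReal.ofReal_one, tsub_le_iff_right]
  exact h1.trans (add_le_add_right ((measure_mono hsub).trans hbad) _)

end PrefProblem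

/-! ### Gibbs measures -/

section Tilted

variable {A : Type*} [MeasurableSpace A]

theorem integrable_of_measurable_of_abs_le {ν : Measure A} [IsFiniteMeasure ν] {f : A → ℝ}
    (hf : Measurable f) {b : ℝ} (hb : ∀ a, |f a| ≤ b) : Integrable f ν :=
  Integrable.of_bound hf.aestronglyMeasurable (C := b) (ae_of_all _ hb)

theorem integrable_exp_of_abs_le {ν : Measure A} [IsFiniteMeasure ν] {f : A → ℝ}
    (hf : Measurable f) {b : ℝ} (hb : ∀ a, |f a| ≤ b) :
    Integrable (fun a => Real.exp (f a)) ν :=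
  integrable_of_measurable_of_abs_le hf.exp (b := Real.exp b) fun a => by
    rw [Real.abs_exp]; exact Real.exp_le_exp.2 ((le_abs_self _).trans (hb a))

theorem tilted_singleton [MeasurableSingletonClass A] (ν : Measure A) (f : A → ℝ) (a : A) :
    ν.tilted f {a} = ENNReal.ofReal (Real.exp (f a) / ∫ b, Real.exp (f b) ∂ν) * ν {a} := by
  rw [tilted_apply' _ _ (measurableSet_singleton a), lintegral_singleton]

/-- The log-density is `f - log Z`, and `Z ≥ 1` because `f ≥ 0`. -/
theorem klDiv_tilted_le {ν : Measure A} [IsProbabilityMeasure ν] {f : A → ℝ} (hf : Measurable f)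
    {b : ℝ} (h0 : ∀ a, 0 ≤ f a) (hb : ∀ a, f a ≤ b) :
    InformationTheory.klDiv (ν.tilted f) ν ≤ ENNReal.ofReal b := by
  have habs : ∀ a, |f a| ≤ b := fun a => by rw [abs_of_nonneg (h0 a)]; exact hb a
  have hexp := integrable_exp_of_abs_le (ν := ν) hf habs
  have : IsProbabilityMeasure (ν.tilted f) := isProbabilityMeasure_tilted hexp
  set Z := ∫ a, Real.exp (f a) ∂ν with hZ
  have hZ1 : 1 ≤ Z := by
    have := integral_mono (integrable_const (μ := ν) (1 : ℝ)) hexp fun a => Real.one_le_exp (h0 a)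
    simpa using this
  have hac := tilted_absolutelyContinuous ν f
  have hllr : llr (ν.tilted f) ν =ᵐ[ν.tilted f] fun a => f a - Real.log Z :=
    hac.ae_le (log_rnDeriv_tilted_left_self hexp)
  have hint : Integrable (fun a => f a - Real.log Z) (ν.tilted f) :=
    (integrable_of_measurable_of_abs_le hf habs).sub (integrable_const _)
  rw [InformationTheory.klDiv_of_ac_of_integrable hac ((integrable_congr hllr).2 hint),
    integral_congr_ae hllr]
  refine ENNReal.ofReal_le_ofReal ?_
  have h1 : ∫ a, (f a - Real.log Z) ∂(ν.tilted f) ≤ ∫ _, b ∂(ν.tilted f) :=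
    integral_mono hint (integrable_const _) fun a => by
      have := hb a
      have := Real.log_nonneg hZ1
      linarith
  simp only [integral_const, probReal_univ, smul_eq_mul, one_mul] at h1
  simp only [probReal_univ]
  linarith

/-- The divergence of two Gibbs measures `∝ e^{η f}` and `∝ e^{η g}` whose densities are bounded by
`C` is at most `C` times the variance of `η (f - g)` under the base measure. -/
theorem log_partition_sub_le {ν : Measure A} [IsProbabilityMeasure ν] {f g : A → ℝ}
    (hf : Measurable f) (hg : Measurable g) {b η C : ℝ} (hη : 0 < η) (hfb : ∀ a, |f a| ≤ b)
    (hgb : ∀ a, |g a| ≤ b)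
    (hfC : ∀ᵐ a ∂ν, Real.exp (η * f a) / ∫ a, Real.exp (η * f a) ∂ν ≤ C)
    (hgC : ∀ᵐ a ∂ν, Real.exp (η * g a) / ∫ a, Real.exp (η * g a) ∂ν ≤ C) :
    η⁻¹ * Real.log (∫ a, Real.exp (η * g a) ∂ν) -
        (∫ a, (g a - f a) ∂(ν.tilted fun a => η * f a) +
          η⁻¹ * Real.log (∫ a, Real.exp (η * f a) ∂ν)) ≤
      η * C * ∫ z : A × A, ((f z.1 - f z.2) - (g z.1 - g z.2)) ^ 2 ∂(ν.prod ν) := by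
  have hef : Integrable (fun a => Real.exp (η * f a)) ν :=
    integrable_exp_of_abs_le (hf.const_mul η) (b := η * b) fun a => by
      rw [abs_mul, abs_of_pos hη]; exact mul_le_mul_of_nonneg_left (hfb a) hη.le
  have heg : Integrable (fun a => Real.exp (η * g a)) ν :=
    integrable_exp_of_abs_le (hg.const_mul η) (b := η * b) fun a => by
      rw [abs_mul, abs_of_pos hη]; exact mul_le_mul_of_nonneg_left (hgb a) hη.le
  have hZf : 0 < ∫ a, Real.exp (η * f a) ∂ν := integral_exp_pos hef
  have hZg : 0 < ∫ a, Real.exp (η * g a) ∂ν := integral_exp_pos heg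
  rw [integral_tilted]
  simp only [smul_eq_mul]
  have hqi := hef.div_const (∫ a, Real.exp (η * f a) ∂ν)
  have hpi := heg.div_const (∫ a, Real.exp (η * g a) ∂ν)
  have hq1 : ∫ a, Real.exp (η * f a) / (∫ a, Real.exp (η * f a) ∂ν) ∂ν = 1 := by
    rw [integral_div, div_self hZf.ne']
  have hp1 : ∫ a, Real.exp (η * g a) / (∫ a, Real.exp (η * g a) ∂ν) ∂ν = 1 := by
    rw [integral_div, div_self hZg.ne']
  set Zf := ∫ a, Real.exp (η * f a) ∂ν
  set Zg := ∫ a, Real.exp (η * g a) ∂ν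
  set q : A → ℝ := fun a => Real.exp (η * f a) / Zf
  set p : A → ℝ := fun a => Real.exp (η * g a) / Zg
  -- The constant for which `log (q/p) = η (f - g) + k`.
  set k : ℝ := Real.log Zg - Real.log Zf with hk
  have hpos : ∀ a, 0 < p a := fun a => div_pos (Real.exp_pos _) hZg
  have hqp : ∀ a, q a = p a * Real.exp (η * (f a - g a) + k) := by
    intro a
    have : Real.exp (η * (f a - g a) + k) =
        Real.exp (η * f a) / Real.exp (η * g a) * (Zg / Zf) := by
      rw [hk, Real.exp_add, Real.exp_sub (Real.log Zg), Real.exp_log hZg, Real.exp_log hZf,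
        mul_sub, Real.exp_sub]
    rw [this]
    simp only [q, p]
    field_simp
  have hdm : Measurable fun a => f a - g a := hf.sub hg
  have hdb : ∀ a, |f a - g a| ≤ 2 * b := fun a => by
    linarith [abs_sub (f a) (g a), hfb a, hgb a]
  have hqd : Integrable (fun a => q a * (f a - g a)) ν :=
    hqi.mul_bdd hdm.aestronglyMeasurable (ae_of_all _ hdb)
  have hpd : Integrable (fun a => p a * (f a - g a)) ν :=
    hpi.mul_bdd hdm.aestronglyMeasurable (ae_of_all _ hdb)
  have hdiff : Integrable (fun a => q a - p a) ν := hqi.sub hpi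
  have hdiffd : Integrable (fun a => q a * (f a - g a) - p a * (f a - g a)) ν := hqd.sub hpd
  -- Since `q - p` has integral zero, the shift `t` is free. The common value `S` is the symmetrized
  -- divergence `KL(q ‖ p) + KL(p ‖ q)`, as `t = k` shows.
  have haff : ∀ t : ℝ, ∫ a, (q a - p a) * (η * (f a - g a) + t) ∂ν =
      η * (∫ a, q a * (f a - g a) ∂ν - ∫ a, p a * (f a - g a) ∂ν) := by
    intro t
    have : ∀ a, (q a - p a) * (η * (f a - g a) + t) =
        η * (q a * (f a - g a) - p a * (f a - g a)) + t * (q a - p a) := fun a => by ring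
    simp_rw [this]
    rw [integral_add (hdiffd.const_mul η) (hdiff.const_mul t),
      integral_const_mul, integral_const_mul, integral_sub hqd hpd, integral_sub hqi hpi, hq1, hp1]
    ring
  have haffi : ∀ t : ℝ, Integrable (fun a => (q a - p a) * (η * (f a - g a) + t)) ν := by
    intro t
    have : (fun a => (q a - p a) * (η * (f a - g a) + t)) = fun a =>
        η * (q a * (f a - g a) - p a * (f a - g a)) + t * (q a - p a) := by funext a; ring
    rw [this]
    exact (hdiffd.const_mul η).add (hdiff.const_mul t)
  set S := η * (∫ a, q a * (f a - g a) ∂ν - ∫ a, p a * (f a - g a) ∂ν) with hS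
  -- The left side is `-KL(p ‖ q)`; hence `KL(q ‖ p) ≤ S`.
  have hjensen : η * (∫ a, p a * (f a - g a) ∂ν) + k ≤ 0 := by
    have hle : ∫ a, p a * (η * (f a - g a) + k) ∂ν ≤ ∫ a, (q a - p a) ∂ν := by
      refine integral_mono ?_ hdiff fun a => ?_
      · have : (fun a => p a * (η * (f a - g a) + k)) = fun a =>
            η * (p a * (f a - g a)) + k * p a := by funext a; ring
        rw [this]
        exact (hpd.const_mul η).add (hpi.const_mul k)
      · change p a * (η * (f a - g a) + k) ≤ q a - p a
        rw [hqp a]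
        nlinarith [Real.add_one_le_exp (η * (f a - g a) + k), hpos a]
    have : ∀ a, p a * (η * (f a - g a) + k) = η * (p a * (f a - g a)) + k * p a :=
      fun a => by ring
    simp_rw [this] at hle
    rw [integral_add (hpd.const_mul η) (hpi.const_mul k), integral_const_mul, integral_const_mul,
      integral_sub hqi hpi, hq1, hp1] at hle
    linarith
  have hsqm : Measurable fun z : A × A => ((f z.1 - f z.2) - (g z.1 - g z.2)) ^ 2 :=
    (((hf.comp measurable_fst).sub (hf.comp measurable_snd)).sub
      ((hg.comp measurable_fst).sub (hg.comp measurable_snd))).pow_const 2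
  have hsqb : ∀ z : A × A, |((f z.1 - f z.2) - (g z.1 - g z.2)) ^ 2| ≤ (4 * b) ^ 2 := by
    intro z
    rw [abs_pow]
    have h1 := abs_le.1 (hdb z.1)
    have h2 := abs_le.1 (hdb z.2)
    have : |(f z.1 - f z.2) - (g z.1 - g z.2)| ≤ 4 * b := by
      rw [abs_le]; constructor <;> linarith [h1.1, h1.2, h2.1, h2.2]
    gcongr
  have hsq := integrable_of_measurable_of_abs_le (ν := ν.prod ν) hsqm hsqb
  -- Compute `S` with the shift that makes `f - g` vanish at `c`, and apply the weighted Young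
  -- inequality with `l = log (q/p)`. The term in `l` integrates to `S/2` and is absorbed on the
  -- left. Averaging over `c` under `ν` then gives the pairwise squared error.
  have hanchor : ∀ c, S ≤ η ^ 2 * C * ∫ a, ((f c - f a) - (g c - g a)) ^ 2 ∂ν := by
    intro c
    have hci : Integrable (fun a => ((f c - f a) - (g c - g a)) ^ 2) ν :=
      integrable_of_measurable_of_abs_le (hsqm.comp (measurable_prodMk_left (x := c)))
        fun a => hsqb (c, a)
    have hle : ∫ a, (q a - p a) * (η * (f a - g a) + -(η * (f c - g c))) ∂ν ≤
        ∫ a, ((q a - p a) * (η * (f a - g a) + k) / 2 +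
          η ^ 2 * C / 2 * ((f c - f a) - (g c - g a)) ^ 2) ∂ν := by
      refine integral_mono_ae (haffi _) (((haffi k).div_const 2).add (hci.const_mul _)) ?_
      filter_upwards [hfC, hgC] with a ha1 ha2
      have h := sub_mul_le_of_eq_mul_exp (h := η * (f a - g a) + -(η * (f c - g c)))
        (hpos a) (hqp a) ha2 ha1
      refine h.trans_eq ?_
      ring
    rw [haff, integral_add ((haffi k).div_const 2) (hci.const_mul _), integral_div, haff,
      integral_const_mul] at hle
    linarith
  have hS2 : S ≤ η ^ 2 * C * ∫ z : A × A, ((f z.1 - f z.2) - (g z.1 - g z.2)) ^ 2 ∂(ν.prod ν) := by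
    rw [integral_prod _ hsq, ← integral_const_mul]
    have := integral_mono (integrable_const (μ := ν) S) (hsq.integral_prod_left.const_mul _) hanchor
    simpa using this
  have hneg : ∫ a, q a * (g a - f a) ∂ν = -∫ a, q a * (f a - g a) ∂ν := by
    rw [← integral_neg]; congr 1; funext a; ring
  have hfinal : η⁻¹ * Real.log Zg - (∫ a, q a * (g a - f a) ∂ν + η⁻¹ * Real.log Zf) =
      η⁻¹ * (η * (∫ a, q a * (f a - g a) ∂ν) + k) := by
    rw [hneg, hk]; field_simp; ring
  change η⁻¹ * Real.log Zg - (∫ a, q a * (g a - f a) ∂ν + η⁻¹ * Real.log Zf) ≤ _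
  rw [hfinal]
  calc η⁻¹ * (η * (∫ a, q a * (f a - g a) ∂ν) + k)
      ≤ η⁻¹ * S := mul_le_mul_of_nonneg_left (by rw [hS]; linarith) (inv_pos.2 hη).le
    _ ≤ η⁻¹ * (η ^ 2 * C * ∫ z : A × A, ((f z.1 - f z.2) - (g z.1 - g z.2)) ^ 2 ∂(ν.prod ν)) :=
        mul_le_mul_of_nonneg_left hS2 (inv_pos.2 hη).le
    _ = _ := by field_simp

end Tilted

theorem integrable_integral_kernel {X Y : Type*} [MeasurableSpace X] [MeasurableSpace Y]
    (μ : Measure X) [IsFiniteMeasure μ] (κ : Kernel X Y) [IsMarkovKernel κ] {h : X × Y → ℝ}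
    (hm : Measurable h) {b : ℝ} (hb : ∀ z, |h z| ≤ b) :
    Integrable (fun x => ∫ y, h (x, y) ∂κ x) μ := by
  refine Integrable.of_bound (C := b)
    hm.stronglyMeasurable.integral_kernel_prod_right'.aestronglyMeasurable (ae_of_all _ fun x => ?_)
  have := norm_integral_le_of_norm_le_const (μ := κ x) (f := fun y => h (x, y)) (C := b)
    (ae_of_all _ fun y => hb (x, y))
  simpa using this

/-! ### Gibbs policies: value, coverage and suboptimality -/

namespace PrefProblem

variable {X A Θ : Type*} [MeasurableSpace X] [MeasurableSpace A] [MeasurableSpace Θ]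

/-- The normalizing constant of the policy `π_θ^η(·|x)`. -/
def partition (P : PrefProblem X A Θ) (θ : Θ) (x : X) : ℝ :=
  ∫ a, Real.exp (P.η * P.R θ x a) ∂P.π₀ x

theorem policy_apply (P : PrefProblem X A Θ) (θ : Θ) (x : X) :
    P.policy θ x = (P.π₀ x).tilted fun a => P.η * P.R θ x a := rfl

theorem measurable_R_section (P : PrefProblem X A Θ) (θ : Θ) (x : X) : Measurable (P.R θ x) :=
  (P.measurable_R_apply θ).comp measurable_prodMk_left

theorem abs_R_le (P : PrefProblem X A Θ) (θ : Θ) (x : X) (a : A) : |P.R θ x a| ≤ P.B := by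
  rw [abs_of_nonneg (P.R_nonneg θ x a)]
  exact P.R_le θ x a

theorem integrable_exp_R (P : PrefProblem X A Θ) (θ : Θ) (x : X) :
    Integrable (fun a => Real.exp (P.η * P.R θ x a)) (P.π₀ x) :=
  integrable_exp_of_abs_le ((P.measurable_R_section θ x).const_mul _) (b := P.η * P.B) fun a => by
    rw [abs_mul, abs_of_pos P.η_pos]
    exact mul_le_mul_of_nonneg_left (P.abs_R_le θ x a) P.η_pos.le

theorem one_le_partition (P : PrefProblem X A Θ) (θ : Θ) (x : X) : 1 ≤ P.partition θ x := by
  have h := integral_mono (integrable_const (μ := P.π₀ x) (1 : ℝ)) (P.integrable_exp_R θ x)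
    fun a => Real.one_le_exp (mul_nonneg P.η_pos.le (P.R_nonneg θ x a))
  simpa [partition] using h

theorem partition_le (P : PrefProblem X A Θ) (θ : Θ) (x : X) :
    P.partition θ x ≤ Real.exp (P.η * P.B) := by
  have h := integral_mono (P.integrable_exp_R θ x)
    (integrable_const (μ := P.π₀ x) (Real.exp (P.η * P.B)))
    fun a => Real.exp_le_exp.2 (mul_le_mul_of_nonneg_left (P.R_le θ x a) P.η_pos.le)
  simpa [partition] using h

theorem measurable_partition (P : PrefProblem X A Θ) (θ : Θ) : Measurable (P.partition θ) :=
  ((P.measurable_R_apply θ).const_mul P.η).exp.stronglyMeasurable.integral_kernel_prod_right'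
    (κ := P.π₀).measurable

/-- The value of the policy `π_θ^η` in the context `x`. -/
def value (P : PrefProblem X A Θ) (θ : Θ) (x : X) : ℝ :=
  ∫ a, (P.R P.θstar x a - P.R θ x a) ∂(P.policy θ x) + P.η⁻¹ * Real.log (P.partition θ x)

theorem integrable_value (P : PrefProblem X A Θ) (θ : Θ) : Integrable (P.value θ) P.d₀ := by
  refine Integrable.add ?_ (Integrable.const_mul ?_ _)
  · refine integrable_integral_kernel P.d₀ (P.policy θ)
      (h := fun z => P.R P.θstar z.1 z.2 - P.R θ z.1 z.2)
      ((P.measurable_R_apply _).sub (P.measurable_R_apply _)) (b := P.B) fun z => ?_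
    have h1 := P.R_nonneg θ z.1 z.2
    have h2 := P.R_nonneg P.θstar z.1 z.2
    have h3 := P.R_le θ z.1 z.2
    have h4 := P.R_le P.θstar z.1 z.2
    rw [abs_le]
    constructor <;> linarith
  · refine integrable_of_measurable_of_abs_le (P.measurable_partition θ).log (b := P.η * P.B)
      fun x => ?_
    have h1 := P.one_le_partition θ x
    rw [abs_of_nonneg (Real.log_nonneg h1), Real.log_le_iff_le_exp (by linarith)]
    exact P.partition_le θ x

/-- At atoms of `π₀` the log-ratio is `η R_θ - log Z`. Actions of `π₀`-mass zero, where the quotient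
takes a default value, are null for the policy too. -/
theorem objective_policy [Countable A] [MeasurableSingletonClass A] (P : PrefProblem X A Θ)
    (θ : Θ) : P.objective (P.policy θ) = ∫ x, P.value θ x ∂P.d₀ := by
  refine integral_congr_ae (ae_of_all _ fun x => ?_)
  have hZ : 0 < P.partition θ x := zero_lt_one.trans_le (P.one_le_partition θ x)
  have hη := P.η_pos
  have hae : ∀ᵐ a ∂P.policy θ x,
      P.R P.θstar x a - P.η⁻¹ * Real.log ((P.policy θ x).real {a} / (P.π₀ x).real {a}) =
        (P.R P.θstar x a - P.R θ x a) + P.η⁻¹ * Real.log (P.partition θ x) := by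
    refine (tilted_absolutelyContinuous (P.π₀ x) _).ae_le ?_
    refine ae_iff_of_countable.2 fun a ha => ?_
    have ha' : (P.π₀ x).real {a} ≠ 0 := by
      rw [Measure.real, ENNReal.toReal_ne_zero]
      exact ⟨ha, measure_ne_top _ _⟩
    have hr : (P.policy θ x).real {a} =
        Real.exp (P.η * P.R θ x a) / P.partition θ x * (P.π₀ x).real {a} := by
      rw [Measure.real, policy_apply, tilted_singleton, ← partition, ENNReal.toReal_mul,
        ENNReal.toReal_ofReal (div_nonneg (Real.exp_pos _).le hZ.le)]
      rfl
    rw [hr, mul_div_cancel_right₀ _ ha', Real.log_div (Real.exp_pos _).ne' hZ.ne', Real.log_exp]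
    field_simp
    ring
  change ∫ a, _ ∂(P.policy θ x) = _
  rw [integral_congr_ae hae, integral_add, integral_const, probReal_univ, one_smul, value]
  · exact (integrable_of_measurable_of_abs_le (P.measurable_R_section _ x) (P.abs_R_le _ x)).sub
      (integrable_of_measurable_of_abs_le (P.measurable_R_section _ x) (P.abs_R_le _ x))
  · exact integrable_const _

/-- Gibbs policies lie in the KL ball, so their densities are bounded by the coverage
coefficient. -/
theorem ae_density_le_localCoverage [Countable A] [MeasurableSingletonClass A]
    (P : PrefProblem X A Θ) (hC : P.localCoverage (2 * P.η * P.B) ≠ ⊤) (θ : Θ) :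
    ∀ᵐ x ∂P.d₀, ∀ᵐ a ∂P.π₀ x, Real.exp (P.η * P.R θ x a) / P.partition θ x ≤
      (P.localCoverage (2 * P.η * P.B)).toReal := by
  have hηB : 0 ≤ P.η * P.B := (mul_pos P.η_pos P.B_pos).le
  -- The divergence is already at most `ηB` in every context, half the allowed radius.
  have hkl : ∫⁻ x, InformationTheory.klDiv (P.policy θ x) (P.π₀ x) ∂P.d₀ ≤
      ENNReal.ofReal (2 * P.η * P.B) := by
    calc ∫⁻ x, InformationTheory.klDiv (P.policy θ x) (P.π₀ x) ∂P.d₀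
        ≤ ∫⁻ _, ENNReal.ofReal (P.η * P.B) ∂P.d₀ := lintegral_mono fun x =>
          klDiv_tilted_le ((P.measurable_R_section θ x).const_mul _)
            (fun a => mul_nonneg P.η_pos.le (P.R_nonneg θ x a))
            (fun a => mul_le_mul_of_nonneg_left (P.R_le θ x a) P.η_pos.le)
      _ = ENNReal.ofReal (P.η * P.B) := by simp
      _ ≤ _ := ENNReal.ofReal_le_ofReal (by linarith)
  have hess : essSup (fun x => ⨆ a, P.policy θ x {a} / P.π₀ x {a}) P.d₀ ≤
      P.localCoverage (2 * P.η * P.B) :=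
    le_iSup_of_le (P.policy θ) (le_iSup_of_le inferInstance (le_iSup_of_le hkl le_rfl))
  filter_upwards [ENNReal.ae_le_essSup fun x => ⨆ a, P.policy θ x {a} / P.π₀ x {a}] with x hx
  refine ae_iff_of_countable.2 fun a ha => ?_
  have h1 := (le_iSup (fun a => P.policy θ x {a} / P.π₀ x {a}) a).trans (hx.trans hess)
  change P.policy θ x {a} / P.π₀ x {a} ≤ _ at h1
  rw [policy_apply, tilted_singleton, ENNReal.mul_div_cancel_right ha (measure_ne_top _ _)] at h1
  exact (ENNReal.ofReal_le_iff_le_toReal hC).1 h1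

/-- Some Gibbs density value is positive and bounded by `C_ρ`. This makes the required sample size
positive and lets `C_ρ` be cancelled from the finer covering radius. -/
theorem localCoverage_toReal_pos [Countable A] [MeasurableSingletonClass A]
    (P : PrefProblem X A Θ) (hC : P.localCoverage (2 * P.η * P.B) ≠ ⊤) :
    0 < (P.localCoverage (2 * P.η * P.B)).toReal := by
  obtain ⟨x, hx⟩ := (P.ae_density_le_localCoverage hC P.θstar).exists
  obtain ⟨a, ha⟩ := hx.exists
  exact (div_pos (Real.exp_pos _) (zero_lt_one.trans_le (P.one_le_partition _ x))).trans_le ha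

/-- The suboptimality is controlled by the mean squared error under the reference policy. -/
theorem gap_le_marginError [Countable A] [MeasurableSingletonClass A] (P : PrefProblem X A Θ)
    (hC : P.localCoverage (2 * P.η * P.B) ≠ ⊤) (θ : Θ) :
    P.gap θ ≤ P.η * (P.localCoverage (2 * P.η * P.B)).toReal * P.marginError P.π₀ θ := by
  rw [gap, objective_policy, objective_policy,
    ← integral_sub (P.integrable_value _) (P.integrable_value _), marginError,
    Measure.integral_compProd (P.integrable_marginError P.π₀ θ P.θstar), ← integral_const_mul]
  refine integral_mono_ae ((P.integrable_value _).sub (P.integrable_value _))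
    (Integrable.const_mul ?_ _) ?_
  · refine integrable_integral_kernel P.d₀ (P.π₀ ×ₖ P.π₀)
      (h := fun z => (P.margin θ z - P.margin P.θstar z) ^ 2)
      (((P.measurable_margin θ).sub (P.measurable_margin P.θstar)).pow_const 2)
      (b := (2 * P.B) ^ 2) fun z => ?_
    have h := abs_sub (P.margin θ z) (P.margin P.θstar z)
    have h1 := P.abs_margin_le θ z
    have h2 := P.abs_margin_le P.θstar z
    rw [abs_pow]
    gcongr
    linarith
  -- Context by context, with `f = R θ` and `g = R θ_*`; the value of the optimal policy is `η⁻¹ log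
  -- Z`, its reward difference being zero.
  · filter_upwards [P.ae_density_le_localCoverage hC θ,
      P.ae_density_le_localCoverage hC P.θstar] with x h1 h2
    have h := log_partition_sub_le (P.measurable_R_section θ x) (P.measurable_R_section P.θstar x)
      P.η_pos (P.abs_R_le θ x) (P.abs_R_le P.θstar x) h1 h2
    rw [Kernel.prod_apply]
    simp only [value, sub_self, integral_zero, zero_add]
    exact h

end PrefProblem

end

/-! ### Sample size and conclusion -/

theorem PrefProblem.runLaw_gap_le {X A Θ : Type*} [MeasurableSpace X] [MeasurableSpace A]
    [MeasurableSpace Θ] [Countable A] [MeasurableSingletonClass A] (P : PrefProblem X A Θ)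
    (hC : P.localCoverage (2 * P.η * P.B) ≠ ⊤) {c κ ε δ r : ℝ} (hc : 0 < c) (hκ : 0 < κ)
    (hε : 0 < ε) (hδ : 0 < δ) (hδ1 : δ < 1) {m n : ℕ} (hmn : (n : ℝ) = c * m)
    (est₀ : (Fin m → Obs X A) → Θ) (h₀ : Measurable est₀)
    {est : (Fin m → Obs X A) × (Fin n → Obs X A) → Θ} (hmle : P.IsFinalMLE est)
    (hN : P.coveringNumber r ≠ ⊤) (hn : κ * P.sampleSize ε δ r ≤ n) :
    ENNReal.ofReal (1 - δ) ≤ P.runLaw m n est₀ h₀ {D | P.gap (est D) ≤ 64 * c / κ * ε +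
      (128 * (1 + c) + 16) *
        (P.η * (P.localCoverage (2 * P.η * P.B)).toReal * (Real.exp P.B * r))} := by
  have hCpos := P.localCoverage_toReal_pos hC
  set C := (P.localCoverage (2 * P.η * P.B)).toReal with hCdef
  have hη := P.η_pos
  have hNpos : (1 : ℝ) ≤ (P.coveringNumber r).toNat := by
    obtain ⟨T, hTcard, hT⟩ := P.exists_finset_cover hN
    obtain ⟨θ', hθ', -⟩ := hT P.θstar
    exact_mod_cast (Finset.card_pos.2 ⟨θ', hθ'⟩).trans_le hTcard
  have hLpos : 0 < Real.log ((P.coveringNumber r).toNat / δ) :=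
    Real.log_pos ((one_lt_div hδ).2 (hδ1.trans_le hNpos))
  rw [PrefProblem.sampleSize, ← hCdef] at hn
  set L := Real.log ((P.coveringNumber r).toNat / δ) with hL
  -- The logarithm is positive as `N ≥ 1 > δ`, so the required sample size is positive, which `n = c
  -- m` with `m = 0` cannot meet.
  have hm : 0 < m := by
    rcases Nat.eq_zero_or_pos m with h | h
    · subst h
      have : 0 < κ * (C * P.η / ε * Real.exp P.B * L) := by positivity
      rw [hmn] at hn
      simp only [Nat.cast_zero, mul_zero] at hn
      linarith
    · exact h
  have hm' : (0 : ℝ) < m := by exact_mod_cast hm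
  refine (P.runLaw_marginError_le hm est₀ h₀ hmle hδ hN).trans (measure_mono fun D hD => ?_)
  have hD' : P.marginError P.π₀ (est D) ≤ Real.exp P.B * (64 * (L / m) +
      (128 * (1 + n / m) + 16) * r) := hD
  have hnm : (n : ℝ) / m = c := by rw [hmn]; field_simp
  rw [hnm] at hD'
  have hLm : P.η * C * Real.exp P.B * (L / m) ≤ c / κ * ε := by
    have h1 : P.η * C * Real.exp P.B * (L / m) =
        κ * (C * P.η / ε * Real.exp P.B * L) * (ε / (κ * m)) := by field_simp
    have h2 : c / κ * ε = c * m * (ε / (κ * m)) := by field_simp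
    rw [h1, h2]
    exact mul_le_mul_of_nonneg_right (hn.trans_eq hmn) (by positivity)
  change P.gap (est D) ≤ _
  calc P.gap (est D) ≤ P.η * C * P.marginError P.π₀ (est D) := P.gap_le_marginError hC _
    _ ≤ P.η * C * (Real.exp P.B * (64 * (L / m) + (128 * (1 + c) + 16) * r)) :=
        mul_le_mul_of_nonneg_left hD' (by positivity)
    _ = 64 * (P.η * C * Real.exp P.B * (L / m)) +
          (128 * (1 + c) + 16) * (P.η * C * (Real.exp P.B * r)) := by ring
    _ ≤ 64 * (c / κ * ε) + (128 * (1 + c) + 16) * (P.η * C * (Real.exp P.B * r)) := by linarith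
    _ = _ := by ring

theorem mainTheorem6 (c κ : ℝ) (hc : 0 < c) (hκ : 0 < κ) :
    ∃ K : ℝ, 0 < K ∧
      ∀ (X : Type*) (A : Type*) (Θ : Type*) [MeasurableSpace X] [MeasurableSpace A]
        [MeasurableSpace Θ] [Countable A] [MeasurableSingletonClass A]
        (P : PrefProblem X A Θ) (_hC : P.localCoverage (2 * P.η * P.B) ≠ ⊤)
        (ε δ : ℝ) (_hε : 0 < ε) (_hδ : 0 < δ) (_hδ' : δ < 1 / 6)
        (m n : ℕ) (_hmn : (n : ℝ) = c * m)
        (est₀ : (Fin m → Obs X A) → Θ) (h₀ : Measurable est₀) (_hmle₀ : P.IsFirstMLE est₀)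
        (est : (Fin m → Obs X A) × (Fin n → Obs X A) → Θ) (_h : Measurable est)
        (_hmle : P.IsFinalMLE est),
        (∀ εc : ℝ, εc = ε / (2 * (1 + c⁻¹) * Real.exp P.B) →
          P.coveringNumber εc ≠ ⊤ → κ * P.sampleSize ε δ εc ≤ n →
          ENNReal.ofReal (1 - 6 * δ) ≤ P.runLaw m n est₀ h₀
            {D | P.gap (est D) ≤
              K * (1 + P.η * (P.localCoverage (2 * P.η * P.B)).toReal) * ε}) ∧
        (∀ εc : ℝ, εc = ε / (2 * (1 + c⁻¹) * Real.exp P.B *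
              (P.η * (P.localCoverage (2 * P.η * P.B)).toReal)) →
          P.coveringNumber εc ≠ ⊤ → κ * P.sampleSize ε δ εc ≤ n →
          ENNReal.ofReal (1 - 6 * δ) ≤ P.runLaw m n est₀ h₀
            {D | P.gap (est D) ≤ K * ε}) := by

  -- The first summand pays for the statistical error, the second for the discretization at radius
  -- `εc`.
  refine ⟨64 * c / κ + (128 * (1 + c) + 16), by positivity, ?_⟩
  intro X A Θ _ _ _ _ _ P hC ε δ hε hδ hδ' m n hmn est₀ h₀ _ est _ hmle
  have hδ1 : δ < 1 := by linarith
  have hCpos := P.localCoverage_toReal_pos hC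
  have hη := P.η_pos
  -- A single failure event of probability at most `δ` occurs.
  have hprob : ENNReal.ofReal (1 - 6 * δ) ≤ ENNReal.ofReal (1 - δ) :=
    ENNReal.ofReal_le_ofReal (by linarith)
  have hhalf : ε / (2 * (1 + c⁻¹)) ≤ ε := by
    have : 0 < c⁻¹ := inv_pos.2 hc
    exact div_le_self hε.le (by linarith)
  have hcκ : 0 ≤ 64 * c / κ := by positivity
  have hc' : 0 ≤ 128 * (1 + c) + 16 := by positivity
  refine ⟨fun εc hεc hN hn => ?_, fun εc hεc hN hn => ?_⟩ <;>
    refine hprob.trans ((P.runLaw_gap_le hC hc hκ hε hδ hδ1 hmn est₀ h₀ hmle hN hn).trans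
      (measure_mono (Set.ofPred_subset_ofPred.2 fun D hD => hD.trans ?_)))
  -- Here `εc` cancels only `e^B`, so the discretization term keeps the factor `η C_ρ`; in the
  -- second case `εc` cancels that factor as well.
  · have hr : Real.exp P.B * εc ≤ ε := by
      refine le_trans (le_of_eq ?_) hhalf
      rw [hεc]; field_simp
    have h1 : P.η * (P.localCoverage (2 * P.η * P.B)).toReal * (Real.exp P.B * εc) ≤
        P.η * (P.localCoverage (2 * P.η * P.B)).toReal * ε :=
      mul_le_mul_of_nonneg_left hr (by positivity)
    have h2 : 0 ≤ 64 * c / κ * (P.η * (P.localCoverage (2 * P.η * P.B)).toReal * ε) := by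
      positivity
    have h3 := mul_le_mul_of_nonneg_left h1 hc'
    have h4 : 0 ≤ (128 * (1 + c) + 16) * ε := by positivity
    linarith
  · have hr : P.η * (P.localCoverage (2 * P.η * P.B)).toReal * (Real.exp P.B * εc) ≤ ε := by
      refine le_trans (le_of_eq ?_) hhalf
      rw [hεc]
      generalize (P.localCoverage (2 * P.η * P.B)).toReal = C at hCpos
      field_simp
    have h3 := mul_le_mul_of_nonneg_left hr hc'
    linarith
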